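/- Let $p$ be a prime, $K=\mathbb{Q}(\mu_p)$, $G=\mathrm{Gal}(K/\mathbb{Q})$, and let $\mathfrak p$ be the unique prime ideal of $K$ above $p$. Let $\omega : G\to\mu_{p-1}(\mathbb{Q}_p)\subset\mathbb{Z}_p^\times$ be the Teichmüller character ($\zeta^s=\zeta^{\omega(s)}$ for $\zeta\in\mu_p$ and $s\in G$), let $\theta=\omega^m$ with $2\le m\le p-2$, and let $e_\theta=\frac{1}{p-1}\sum_{s\in G}\theta(s^{-1})\,s\in\mathbb{Z}_p[G]$. For $x\in K^\times$ and an integral ideal $I$ that is a power of $\mathfrak p$, write $x\equiv 1 \pmod I$ if $x-1$ lies in $I$ localized at $\mathfrak p$. An element $x\in K^\times$ prime to $p$ is called $p$-primary if $K(\sqrt[p]{x})/K$ is unramified at $\mathfrak p$. Let $\alpha\in K^\times$ with $\alpha\equiv 1\pmod{\mathfrak p}$, and let $N\ge 1$ be an integer. If $e\in\mathbb{Z}[G]$ and $e\equiv e_\theta\pmod{p^N\mathbb{Z}_p[G]}$, then $\alpha^{e}\equiv 1\pmod{\mathfrak p}$. More generally, let $\alpha_\theta\in K^\times$ be any representative of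 the class of $\alpha^{e_\theta}$ in $K^\times/(K^{\times})^{p^N}$, that is, $\alpha_\theta=\alpha^{e}x^{p^N}$ with such an $e$ and some $x\in K^\times$, and suppose that it is normalized by $\alpha_\theta\equiv1\pmod{\mathfrak p}$. Then: (1) $\alpha_\theta\equiv 1\pmod{\mathfrak p^m}$; (2) $\alpha_\theta$ is $p$-primary if and only if $\alpha_\theta\equiv 1\pmod{p}$; (3) if $N\ge 2$ or $m=2$, and $\alpha_\theta$ is $p$-primary, then $\alpha_\theta\equiv 1\pmod{\mathfrak p^{m+p-1}}$, where $\mathfrak p^{m+p-1}=(p)\,\mathfrak p^m$. -/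

import Mathlib

open NumberField Polynomial

section Defs

variable (p : ℕ) [Fact p.Prime]

/-- A ring homomorphism `ℤ_p → 𝔽_p` is unique: it is the reduction modulo `p`. -/
theorem padicInt_toZMod_eq (f : ℤ_[p] →+* ZMod p) (x : ℤ_[p]) : f x = PadicInt.toZMod x := by
  have hx : x - (PadicInt.zmodRepr x : ℤ_[p]) ∈ Ideal.span {(p : ℤ_[p])} := by
    rw [← PadicInt.maximalIdeal_eq_span_p]
    exact PadicInt.sub_zmodRepr_mem x
  obtain ⟨y, hy⟩ := Ideal.mem_span_singleton.1 hx
  have h1 : x = (PadicInt.zmodRepr x : ℤ_[p]) + p * y := by rw [← hy]; ring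
  rw [h1]
  simp

variable (K : Type*) [Field K] [NumberField K] [IsCyclotomicExtension {p} ℚ K]

/-- The Teichmüller character `ω : G → ℤ_pˣ ⊆ ℤ_p` of `G = Gal(K/ℚ)`, `K = ℚ(μ_p)`: if `s`
raises `p`-th roots of unity to the power `a ∈ (ℤ/p)ˣ`, then `ω s` is the Teichmüller
representative of `a` in `ℤ_p`, the ring of Witt vectors of `𝔽_p`. -/
noncomputable def teichmullerChar : (K ≃ₐ[ℚ] K) →* ℤ_[p] :=
  ((WittVector.equiv p : WittVector p (ZMod p) →* ℤ_[p]).comp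
      (WittVector.teichmuller p)).comp
    ((Units.coeHom (ZMod p)).comp
      ((IsCyclotomicExtension.zeta_spec p ℚ K).autToPow ℚ))

/-- `ω` takes its values in the group `μ_{p-1}` of `(p-1)`-st roots of unity. -/
theorem teichmullerChar_pow (s : K ≃ₐ[ℚ] K) : teichmullerChar p K s ^ (p - 1) = 1 := by
  rw [← map_pow]
  simp only [teichmullerChar, MonoidHom.comp_apply, map_pow]
  rw [← map_pow, ← map_pow, ← map_pow, ZMod.units_pow_card_sub_one_eq_one]
  simp

/-- `ζ^s = ζ^{ω(s)}` for every `p`-th root of unity `ζ`. -/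
theorem teichmullerChar_spec (s : K ≃ₐ[ℚ] K) (ζ : K) (hζ : ζ ^ p = 1) :
    s ζ = ζ ^ (PadicInt.toZMod (teichmullerChar p K s)).val := by
  have h1 : PadicInt.toZMod (teichmullerChar p K s) =
      (((IsCyclotomicExtension.zeta_spec p ℚ K).autToPow ℚ s : (ZMod p)ˣ) : ZMod p) := by
    rw [← padicInt_toZMod_eq p (WittVector.constantCoeff.comp
      ((WittVector.equiv p).symm : ℤ_[p] →+* WittVector p (ZMod p)))]
    simp [teichmullerChar, WittVector.teichmuller_coeff_zero]
  rw [h1]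
  obtain ⟨i, -, rfl⟩ := (IsCyclotomicExtension.zeta_spec p ℚ K).eq_pow_of_pow_eq_one hζ
  rw [map_pow, ← IsPrimitiveRoot.autToPow_spec ℚ (IsCyclotomicExtension.zeta_spec p ℚ K) s,
    ← pow_mul, ← pow_mul, mul_comm]

/-- The idempotent `e_θ = (1/(p-1)) ∑_{s ∈ G} θ(s⁻¹) s` of `ℤ_p[G]`
(`p - 1` is a unit of `ℤ_p`). -/
noncomputable def idempotentOf (θ : (K ≃ₐ[ℚ] K) →* ℤ_[p]) : MonoidAlgebra ℤ_[p] (K ≃ₐ[ℚ] K) :=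
  ∑ s : K ≃ₐ[ℚ] K, MonoidAlgebra.single s (Ring.inverse ((p : ℤ_[p]) - 1) * θ s⁻¹)

/-- `e ∈ ℤ[G]` approximates `e_θ` modulo `p ^ N`: `e ≡ e_θ (mod p ^ N ℤ_p[G])`. -/
def ApproximatesIdempotent (θ : (K ≃ₐ[ℚ] K) →* ℤ_[p]) (N : ℕ)
    (e : MonoidAlgebra ℤ (K ≃ₐ[ℚ] K)) : Prop :=
  ∃ f : MonoidAlgebra ℤ_[p] (K ≃ₐ[ℚ] K),
    MonoidAlgebra.mapRingHom (K ≃ₐ[ℚ] K) (Int.castRingHom ℤ_[p]) e =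
      idempotentOf p K θ + (p : ℤ_[p]) ^ N • f

variable {K}

/-- The action of the group ring on `K ˣ`, written exponentially:
`α ^ e = ∏_s s(α) ^ {n_s}` for `e = ∑_s n_s s ∈ ℤ[G]`. -/
noncomputable def galoisPow (α : Kˣ) (e : MonoidAlgebra ℤ (K ≃ₐ[ℚ] K)) : Kˣ :=
  ∏ s : K ≃ₐ[ℚ] K, (s • α) ^ e.coeff s

/-- `β` is a `θ`-component of `α` modulo `p ^ N`-th powers: a representative in `K ˣ` of the class
`α ^ {e_θ} ∈ K ˣ / K ˣ ^ {p ^ N}`, where `e_θ` acts through its reduction modulo `p ^ N`. -/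
def IsThetaComponent (θ : (K ≃ₐ[ℚ] K) →* ℤ_[p]) (N : ℕ) (α β : Kˣ) : Prop :=
  ∃ e : MonoidAlgebra ℤ (K ≃ₐ[ℚ] K), ApproximatesIdempotent p K θ N e ∧
    ∃ x : Kˣ, β = galoisPow α e * x ^ p ^ N

/-- The congruence `x ≡ 1 (mod I)` in `K`, localized at the prime `𝔭`: `x - 1` lies in `I 𝓞_𝔭`,
where `𝓞_𝔭 ⊆ K` is the localization of the ring of integers at `𝔭`. -/
def CongrOne (𝔭 I : Ideal (𝓞 K)) (x : Kˣ) : Prop :=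
  ∃ a ∈ I, ∃ b : 𝓞 K, b ∉ 𝔭 ∧ (b : K) * ((x : K) - 1) = (a : K)

/-- `α` (prime to `p`) is `p`-primary: the Kummer extension `K(α ^ {1/p}) / K`, i.e. the splitting
field of `X ^ p - α` over `K ∋ ζ_p`, is unramified at the prime `𝔭` above `p`. -/
def IsPPrimary (𝔭 : Ideal (𝓞 K)) (α : Kˣ) : Prop :=
  Algebra.IsUnramifiedIn (𝓞 (X ^ p - C (α : K) : K[X]).SplittingField) 𝔭

end Defs

/-
Put `U_k = 1 + 𝔭 ^ k`, inside the group of units at `𝔭`. A generator `σ` of `Gal(K/ℚ)`, with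
`σ ζ = ζ ^ g`, acts on `U_k / U_{k+1}` by `g ^ k`. On the other hand `σ β = β ^ a * z ^ p ^ N` with
`a ≡ g ^ m` modulo `p` and `z ∈ U_1`. Since `U_1 = ⟨ζ⟩ U_2`, the `p`-th powers of elements of `U_1`
lie in `U_{p+1}` and their `p ^ 2`-th powers in `U_{2p}`. Below these bounds `β ∈ U_k` therefore
forces `β ∈ U_{k+1}`, unless `k ≡ m` modulo `p - 1`.

For `β ∈ U_1`, being `p`-primary means `β ∈ U_p`. If `b ^ p = β ∈ U_p`, then `(b - 1) / (ζ - 1)`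
generates `K(b)` and is a root of an Artin–Schreier polynomial modulo `𝔭`. Conversely, if `K(b)` is
unramified at `𝔭`, then a valuation of `K(b)` above that of `𝔭` has the same value group, so `b` is
a higher unit for it and `b ^ p` is congruent to `1` modulo `𝔭 ^ p`.
-/

section Valuation

open WithZero

variable {x y : ℤᵐ⁰}

theorem mul_le_exp_neg {a b c : ℕ} (hx : x ≤ exp (-(a : ℤ))) (hy : y ≤ exp (-(b : ℤ)))
    (hc : c ≤ a + b) : x * y ≤ exp (-(c : ℤ)) := by
  refine (mul_le_mul' hx hy).trans ?_
  rw [← exp_add, exp_le_exp]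
  omega

theorem pow_le_exp_neg {a c n : ℕ} (hx : x ≤ exp (-(a : ℤ))) (hc : c ≤ n * a) :
    x ^ n ≤ exp (-(c : ℤ)) := by
  refine (pow_le_pow_left' hx n).trans ?_
  rw [← exp_nsmul, exp_le_exp, nsmul_eq_mul, mul_neg, neg_le_neg_iff]
  exact_mod_cast hc

theorem lt_one_iff_le_exp_neg_one : x < 1 ↔ x ≤ exp (-1) := by
  rw [← lt_mul_exp_iff_le exp_ne_zero, ← exp_add, neg_add_cancel, exp_zero]

theorem lt_one_of_le_exp_neg {k : ℕ} (hk : 1 ≤ k) (hx : x ≤ exp (-(k : ℤ))) : x < 1 :=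
  lt_one_iff_le_exp_neg_one.2 (hx.trans (exp_le_exp.2 (by omega)))

variable {L : Type*} [Field L]

section General

variable {Γ₀ : Type*} [LinearOrderedCommGroupWithZero Γ₀] (w : Valuation L Γ₀)

theorem valuation_natCast_le_one (n : ℕ) : w n ≤ 1 := (n : w.integer).2

theorem valuation_one_add_pow_sub_le {t : L} (ht : w t ≤ 1) (n : ℕ) :
    w ((1 + t) ^ n - 1 - n * t) ≤ w t ^ 2 := by
  induction n with
  | zero => simp
  | succ n ih =>
    have h : (1 + t) ^ (n + 1) - 1 - (n + 1 : ℕ) * t =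
        ((1 + t) ^ n - 1 - n * t) * (1 + t) + n * t ^ 2 := by push_cast; ring
    rw [h]
    refine w.map_add_le ?_ ?_
    · rw [map_mul]
      exact mul_le_of_le_of_le_one ih (w.map_add_le (by simp) ht)
    · rw [map_mul, map_pow]
      exact mul_le_of_le_one_left' (valuation_natCast_le_one w n)

theorem exists_one_add_pow_prime_eq {p : ℕ} (hp : p.Prime) {t : L} (ht : w t ≤ 1) :
    ∃ r : L, w r ≤ 1 ∧ (1 + t) ^ p = 1 + t ^ p + p * t * r := by
  obtain ⟨r, hr⟩ := exists_add_pow_prime_eq hp 1 (⟨t, ht⟩ : w.integer)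
  refine ⟨r, r.2, ?_⟩
  simpa using congrArg Subtype.val hr

theorem valuation_lt_one_of_one_add_pow_prime {p : ℕ} (hp : p.Prime) (hwp : w p < 1)
    {t : L} (ht : w t ≤ 1) (h : w ((1 + t) ^ p - 1) < 1) : w t < 1 := by
  obtain ⟨r, hr, he⟩ := exists_one_add_pow_prime_eq w hp ht
  have hptr : w (p * t * r) < 1 := by
    rw [map_mul, map_mul]
    exact mul_lt_one_of_lt_of_le (mul_lt_one_of_lt_of_le hwp ht) hr
  have htp : w t ^ p < 1 := by
    rw [← map_pow, show t ^ p = ((1 + t) ^ p - 1) - p * t * r by rw [he]; ring]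
    exact w.map_sub_lt h hptr
  exact (pow_lt_one_iff hp.ne_zero).1 htp

end General

variable (w : Valuation L ℤᵐ⁰)

/-- The `k`-th higher unit group `U_k = 1 + 𝔪 ^ k` of a valuation with values in `ℤᵐ⁰`. The
condition `w x = 1` only matters for `k = 0`, where it makes `U_0` the group of all units. -/
def higherUnits (k : ℕ) : Subgroup Lˣ where
  carrier := {x | w x = 1 ∧ w ((x : L) - 1) ≤ exp (-(k : ℤ))}
  one_mem' := by simp
  mul_mem' := by
    rintro x y ⟨hx, hx'⟩ ⟨hy, hy'⟩
    refine ⟨by simp [hx, hy], ?_⟩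
    rw [show ((x * y : Lˣ) : L) - 1 = x * (y - 1) + (x - 1) by push_cast; ring]
    exact w.map_add_le (by rwa [map_mul, hx, one_mul]) hx'
  inv_mem' := by
    rintro x ⟨hx, hx'⟩
    refine ⟨by simp [hx], ?_⟩
    rw [show ((x⁻¹ : Lˣ) : L) - 1 = -((x⁻¹ : Lˣ) * (x - 1)) by rw [mul_sub, Units.inv_mul]; ring,
      Valuation.map_neg, map_mul]
    simpa [hx] using hx'

variable {w} {p k : ℕ} {u : Lˣ}

theorem mem_higherUnits_iff (hk : 1 ≤ k) :
    u ∈ higherUnits w k ↔ w ((u : L) - 1) ≤ exp (-(k : ℤ)) := by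
  refine ⟨And.right, fun h => ⟨?_, h⟩⟩
  simpa using w.map_one_add_of_lt (lt_one_of_le_exp_neg hk h)

theorem higherUnits_anti : Antitone (higherUnits w) :=
  fun _ _ h _ hu => ⟨hu.1, hu.2.trans (exp_le_exp.2 (by omega))⟩

theorem pow_prime_mem_higherUnits {n : ℕ} (hp : p.Prime) (hwp : w p ≤ exp (-((p - 1 : ℕ) : ℤ)))
    (hu : u ∈ higherUnits w k) (hn : n ≤ p * k) (hn' : n ≤ p - 1 + k) :
    u ^ p ∈ higherUnits w n := by
  obtain ⟨r, hr, he⟩ := exists_one_add_pow_prime_eq w hp (w.map_sub_le hu.1.le w.map_one.le)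
  refine ⟨by simp [hu.1], ?_⟩
  rw [add_sub_cancel] at he
  rw [Units.val_pow_eq_pow_val, he, add_assoc, add_sub_cancel_left]
  refine w.map_add_le ?_ ?_
  · rw [map_pow]
    exact pow_le_exp_neg hu.2 hn
  · rw [map_mul, map_mul]
    exact mul_le_of_le_of_le_one (mul_le_exp_neg hwp hu.2 hn') hr

theorem mem_higherUnits_one_of_pow_prime (hp : p.Prime) (hwp : w p < 1)
    (hu : u ^ p ∈ higherUnits w 1) : u ∈ higherUnits w 1 := by
  have hw : w u = 1 := by
    have h := hu.1
    rw [Units.val_pow_eq_pow_val, map_pow] at h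
    exact (pow_eq_one_iff.1 h).resolve_right hp.ne_zero
  refine ⟨hw, lt_one_iff_le_exp_neg_one.1 ?_⟩
  refine valuation_lt_one_of_one_add_pow_prime w hp hwp (w.map_sub_le hw.le w.map_one.le) ?_
  rw [add_sub_cancel]
  exact lt_one_of_le_exp_neg le_rfl hu.2

theorem mem_higherUnits_one_of_pow_prime_pow (hp : p.Prime) (hwp : w p < 1) {N : ℕ}
    (hu : u ^ p ^ N ∈ higherUnits w 1) : u ∈ higherUnits w 1 := by
  induction N with
  | zero => simpa using hu
  | succ N ih =>
    rw [pow_succ, pow_mul] at hu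
    exact ih (mem_higherUnits_one_of_pow_prime hp hwp hu)

theorem pow_prime_mem_higherUnits_of_mem_one (hp : p.Prime)
    (hwp : w p ≤ exp (-((p - 1 : ℕ) : ℤ))) (hu : u ^ p ∈ higherUnits w 1) :
    u ^ p ∈ higherUnits w p := by
  have hp2 := hp.two_le
  exact pow_prime_mem_higherUnits hp hwp (mem_higherUnits_one_of_pow_prime hp
    (lt_one_of_le_exp_neg (by omega) hwp) hu) (by omega) (by omega)

variable (w) in
/-- The residue field of `w` is a prime field: every integral element is congruent to a natural
number modulo the maximal ideal. -/
def HasPrimeResidueField : Prop := ∀ x : L, w x ≤ 1 → ∃ n : ℕ, w (x - n) < 1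

theorem HasPrimeResidueField.exists_mul_pow_mem_higherUnits_succ (hw : HasPrimeResidueField w)
    (hk : 1 ≤ k) {y : Lˣ} (hu : u ∈ higherUnits w k) (hy : w ((y : L) - 1) = exp (-(k : ℤ))) :
    ∃ i : ℕ, u * y ^ i ∈ higherUnits w (k + 1) := by
  have hyU : y ∈ higherUnits w k := (mem_higherUnits_iff hk).2 hy.le
  have hy0 : (y : L) - 1 ≠ 0 := w.ne_zero_iff.1 (hy.trans_ne exp_ne_zero)
  obtain ⟨i, hi⟩ := hw (-((u : L) - 1) / (y - 1)) <| by
    rw [map_div₀, Valuation.map_neg, hy]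
    exact div_le_one_of_le₀ hu.2 zero_le
  refine ⟨i, (mem_higherUnits_iff k.succ_pos).2 ?_⟩
  have hfirst : w (((u : L) - 1) + i * (y - 1)) ≤ exp (-((k + 1 : ℕ) : ℤ)) := by
    rw [show ((u : L) - 1) + i * (y - 1) = -((y - 1) * (-((u : L) - 1) / (y - 1) - i)) by
      field_simp; ring, Valuation.map_neg, map_mul]
    exact mul_le_exp_neg hy.le (lt_one_iff_le_exp_neg_one.1 hi) le_rfl
  have hsecond : w ((y : L) ^ i - 1 - i * (y - 1)) ≤ exp (-((k + 1 : ℕ) : ℤ)) := by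
    have h := valuation_one_add_pow_sub_le w (t := (y : L) - 1)
      (lt_one_of_le_exp_neg hk hy.le).le i
    rw [add_sub_cancel] at h
    exact h.trans (pow_le_exp_neg hy.le (by omega))
  have hcross : w (((u : L) - 1) * ((y : L) ^ i - 1)) ≤ exp (-((k + 1 : ℕ) : ℤ)) := by
    have h : w ((y : L) ^ i - 1) ≤ exp (-(k : ℤ)) := by simpa using (pow_mem hyU i).2
    rw [map_mul]
    exact mul_le_exp_neg hu.2 h (by omega)
  rw [show ((u * y ^ i : Lˣ) : L) - 1 = (((u : L) - 1) + i * (y - 1)) +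
    ((y : L) ^ i - 1 - i * (y - 1)) + ((u : L) - 1) * ((y : L) ^ i - 1) by push_cast; ring]
  exact w.map_add_le (w.map_add_le hfirst hsecond) hcross

theorem HasPrimeResidueField.pow_prime_mem_higherUnits_succ (hw : HasPrimeResidueField w)
    (hp : p.Prime) (hwp : w p ≤ exp (-((p - 1 : ℕ) : ℤ))) {ζ : Lˣ} (hζ : ζ ^ p = 1)
    (hζ1 : w ((ζ : L) - 1) = exp (-1)) (hu : u ∈ higherUnits w 1) :
    u ^ p ∈ higherUnits w (p + 1) := by
  obtain ⟨i, hi⟩ := hw.exists_mul_pow_mem_higherUnits_succ le_rfl hu hζ1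
  have hpow : (u * ζ ^ i) ^ p = u ^ p := by
    rw [mul_pow, ← pow_mul, mul_comm i, pow_mul, hζ, one_pow, mul_one]
  have hp2 := hp.two_le
  exact hpow ▸ pow_prime_mem_higherUnits hp hwp hi (by omega) (by omega)

theorem HasPrimeResidueField.valuation_map_sub_lt_one (hw : HasPrimeResidueField w) {σ : L →+* L}
    (hσ : ∀ x, w (σ x) = w x) {c : L} (hc : w c ≤ 1) : w (σ c - c) < 1 := by
  obtain ⟨n, hn⟩ := hw c hc
  rw [show σ c - c = σ (c - n) - (c - n) by rw [map_sub, map_natCast]; ring]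
  exact w.map_sub_lt ((hσ _).trans_lt hn) hn

theorem valuation_map_sub_pow_mul_le {σ : L →+* L} (hσ : ∀ c, w c ≤ 1 → w (σ c - c) < 1)
    {π g : L} (hπ : w π = exp (-1)) (hg : w g ≤ 1) (hσπ : w (σ π - g * π) ≤ exp (-2)) {t : L}
    (ht : w t ≤ exp (-(k : ℤ))) : w (σ t - g ^ k * t) ≤ exp (-((k + 1 : ℕ) : ℤ)) := by
  induction k generalizing t with
  | zero =>
    rw [pow_zero, one_mul]
    exact lt_one_iff_le_exp_neg_one.1 (hσ t ht)
  | succ k ih =>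
    have hπ0 : π ≠ 0 := w.ne_zero_iff.1 (hπ.trans_ne exp_ne_zero)
    have hσπ1 : w (σ π) ≤ exp (-1) := by
      rw [← sub_add_cancel (σ π) (g * π)]
      refine w.map_add_le (hσπ.trans (exp_le_exp.2 (by norm_num))) ?_
      rw [map_mul, hπ]
      exact mul_le_of_le_one_left' hg
    obtain ⟨s, rfl⟩ : ∃ s, t = π * s := ⟨t / π, by field_simp⟩
    have hs : w s ≤ exp (-(k : ℤ)) := by
      rw [map_mul, hπ] at ht
      refine le_of_mul_le_mul_left (ht.trans_eq ?_) (exp_pos (a := -1))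
      rw [← exp_add]
      congr 1
      omega
    rw [show σ (π * s) - g ^ (k + 1) * (π * s) =
      σ π * (σ s - g ^ k * s) + (σ π - g * π) * (g ^ k * s) by rw [map_mul]; ring]
    refine w.map_add_le ?_ ?_
    · rw [map_mul]
      exact mul_le_exp_neg (a := 1) hσπ1 (ih hs) (by omega)
    · rw [map_mul, map_mul, map_pow]
      exact mul_le_exp_neg (a := 2) hσπ (mul_le_of_le_one_of_le (pow_le_one' hg k) hs) (by omega)

/-- Modulo `U_{k+1}`, `σ` acts on `u` both by the scalar `c` and by the scalar `a`. -/
theorem mem_higherUnits_succ_of_map_eq (hk : 1 ≤ k) {σ : L →+* L} {c : L} {a : ℕ} {z : Lˣ}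
    (hu : u ∈ higherUnits w k) (hz : z ∈ higherUnits w (k + 1)) (hσu : σ u = u ^ a * z)
    (hc : w (σ ((u : L) - 1) - c * (u - 1)) ≤ exp (-((k + 1 : ℕ) : ℤ))) (hca : w (c - a) = 1) :
    u ∈ higherUnits w (k + 1) := by
  have hpow : w ((u : L) ^ a - 1 - a * ((u : L) - 1)) ≤ exp (-((k + 1 : ℕ) : ℤ)) := by
    have h := valuation_one_add_pow_sub_le w (t := (u : L) - 1)
      (lt_one_of_le_exp_neg hk hu.2).le a
    rw [add_sub_cancel] at h
    exact h.trans (pow_le_exp_neg hu.2 (by omega))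
  have hz' : w ((u : L) ^ a * (z - 1)) ≤ exp (-((k + 1 : ℕ) : ℤ)) := by
    rw [map_mul, map_pow, hu.1, one_pow, one_mul]
    exact hz.2
  have hdiff : (c - a) * ((u : L) - 1) = (u : L) ^ a * (z - 1) +
      ((u : L) ^ a - 1 - a * ((u : L) - 1)) - (σ ((u : L) - 1) - c * (u - 1)) := by
    rw [map_sub, map_one, hσu]; ring
  refine ⟨hu.1, ?_⟩
  rw [← one_mul (w ((u : L) - 1)), ← hca, ← map_mul, hdiff]
  exact w.map_sub_le (w.map_add_le hz' hpow) hc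

end Valuation

section DedekindDomain

open WithZero IsDedekindDomain

variable {R : Type*} [CommRing R] [IsDedekindDomain R] {v : HeightOneSpectrum R}

theorem intValuation_le_intValuation {x y : R} (hy : y ≠ 0)
    (h : ∀ n, y ∈ v.asIdeal ^ n → x ∈ v.asIdeal ^ n) : v.intValuation x ≤ v.intValuation y := by
  have hle := v.intValuation_eq_exp_neg_multiplicity hy
  rw [hle, v.intValuation_le_pow_iff_mem]
  exact h _ ((v.intValuation_le_pow_iff_mem _ _).1 hle.le)

theorem intValuation_map_eq {τ : R ≃+* R} (hτ : v.asIdeal.map τ = v.asIdeal) (x : R) :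
    v.intValuation (τ x) = v.intValuation x := by
  rcases eq_or_ne x 0 with rfl | hx
  · rw [map_zero]
  have hmem (n : ℕ) : τ x ∈ v.asIdeal ^ n ↔ x ∈ v.asIdeal ^ n := by
    conv_lhs => rw [← hτ, ← Ideal.map_pow, Ideal.mem_map_of_equiv]
    exact ⟨fun ⟨_, hy, hyx⟩ => τ.injective hyx ▸ hy, fun h => ⟨x, h, rfl⟩⟩
  exact le_antisymm (intValuation_le_intValuation hx fun n => (hmem n).2)
    (intValuation_le_intValuation ((map_ne_zero_iff τ τ.injective).2 hx) fun n => (hmem n).1)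

variable {K : Type*} [Field K] [Algebra R K] [IsFractionRing R K]

theorem valuation_map_eq {σ : K →+* K} {τ : R ≃+* R}
    (hστ : ∀ r, σ (algebraMap R K r) = algebraMap R K (τ r)) (hτ : v.asIdeal.map τ = v.asIdeal)
    (x : K) : v.valuation K (σ x) = v.valuation K x := by
  obtain ⟨a, b, -, rfl⟩ := IsFractionRing.div_surjective (A := R) x
  simp only [map_div₀, hστ, v.valuation_of_algebraMap, intValuation_map_eq hτ]

theorem valuation_natCast_lt_one {n : ℕ} (hn : (n : R) ∈ v.asIdeal) : v.valuation K n < 1 := by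
  rw [← map_natCast (algebraMap R K)]
  exact (v.valuation_lt_one_iff_mem _).2 hn

theorem hasPrimeResidueField_valuation (hv : (Nat.card (R ⧸ v.asIdeal)).Prime) :
    HasPrimeResidueField (v.valuation K) := by
  have : Finite (R ⧸ v.asIdeal) := Nat.finite_of_card_ne_zero hv.ne_zero
  have := Fintype.ofFinite (R ⧸ v.asIdeal)
  let f := ZMod.ringEquivOfPrime (R ⧸ v.asIdeal) hv Nat.card_eq_fintype_card.symm
  intro x hx
  obtain ⟨a, ha⟩ := v.exists_valuation_sub_lt_of_integer hx 1
  have : NeZero (Nat.card (R ⧸ v.asIdeal)) := ⟨hv.ne_zero⟩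
  obtain ⟨n, hn⟩ := ZMod.natCast_zmod_surjective (f.symm (Ideal.Quotient.mk _ a))
  have han : a - n ∈ v.asIdeal := by
    rw [← Ideal.Quotient.mk_eq_mk_iff_sub_mem, map_natCast, ← map_natCast f, hn,
      RingEquiv.apply_symm_apply]
  refine ⟨n, ?_⟩
  rw [show x - n = algebraMap R K (a - n) - (algebraMap R K a - x) by
    rw [map_sub, map_natCast]; ring]
  exact (v.valuation K).map_sub_lt ((v.valuation_lt_one_iff_mem _).2 han) (by simpa using ha)

end DedekindDomain

section Cyclotomic

open WithZero IsDedekindDomain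

variable {p : ℕ} {K : Type*} [Field K] [NumberField K] {v : HeightOneSpectrum (𝓞 K)} {k : ℕ}
  {x : Kˣ}

theorem congrOne_pow_iff : CongrOne v.asIdeal (v.asIdeal ^ k) x ↔
    v.valuation K ((x : K) - 1) ≤ exp (-(k : ℤ)) := by
  have val_eq {a b : 𝓞 K} (hb : b ∉ v.asIdeal) (h : (b : K) * ((x : K) - 1) = a) :
      v.valuation K ((x : K) - 1) = v.intValuation a := by
    have h' := congrArg (v.valuation K) h
    rwa [map_mul, v.valuation_eq_one_iff_notMem.2 hb, one_mul, v.valuation_of_algebraMap] at h'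
  constructor
  · rintro ⟨a, ha, b, hb, h⟩
    rwa [val_eq hb h, v.intValuation_le_pow_iff_mem]
  · intro h
    obtain ⟨a, ⟨b, hb⟩, hab⟩ := v.exists_primeCompl_mul_eq_of_integer ((x : K) - 1)
      (h.trans (exp_le_exp.2 (by omega)))
    have hba : (b : K) * ((x : K) - 1) = a := by rw [mul_comm]; exact hab
    exact ⟨a, (v.intValuation_le_pow_iff_mem _ _).1 (val_eq hb hba ▸ h), b, hb, hba⟩

theorem congrOne_pow_iff_mem_higherUnits (hk : 1 ≤ k) :
    CongrOne v.asIdeal (v.asIdeal ^ k) x ↔ x ∈ higherUnits (v.valuation K) k :=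
  congrOne_pow_iff.trans (mem_higherUnits_iff hk).symm

theorem congrOne_iff_mem_higherUnits_one :
    CongrOne v.asIdeal v.asIdeal x ↔ x ∈ higherUnits (v.valuation K) 1 := by
  rw [← congrOne_pow_iff_mem_higherUnits le_rfl, pow_one]

variable [Fact p.Prime]

theorem liesOver_span_natCast {R : Type*} [CommRing R] {P : Ideal R} [P.IsPrime]
    (hP : (p : R) ∈ P) : P.LiesOver (Ideal.span {(p : ℤ)}) := by
  have : (Ideal.span {(p : ℤ)}).IsMaximal := Int.ideal_span_isMaximal_of_prime p
  refine ⟨this.eq_of_le (Ideal.comap_ne_top _ Ideal.IsPrime.ne_top') ?_⟩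
  rw [Ideal.span_singleton_le_iff_mem]
  simpa [Ideal.mem_comap] using hP

theorem exists_heightOneSpectrum_asIdeal_eq {P : Ideal (𝓞 K)} [hP' : P.IsPrime]
    (hP : (p : 𝓞 K) ∈ P) : ∃ v : HeightOneSpectrum (𝓞 K), v.asIdeal = P :=
  ⟨⟨P, hP', (Submodule.ne_bot_iff P).2 ⟨p, hP, NeZero.ne _⟩⟩, rfl⟩

variable [IsCyclotomicExtension {p} ℚ K]

theorem eq_span_zeta_sub_one_of_natCast_mem {ζ : K} (hζ : IsPrimitiveRoot ζ p) {P : Ideal (𝓞 K)}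
    [P.IsPrime] (hP : (p : 𝓞 K) ∈ P) : P = Ideal.span {hζ.toInteger - 1} :=
  have := liesOver_span_natCast hP
  IsCyclotomicExtension.Rat.eq_span_zeta_sub_one_of_liesOver' p K hζ P

theorem eq_of_natCast_mem {P Q : Ideal (𝓞 K)} [P.IsPrime] [Q.IsPrime] (hP : (p : 𝓞 K) ∈ P)
    (hQ : (p : 𝓞 K) ∈ Q) : P = Q := by
  have hζ := IsCyclotomicExtension.zeta_spec p ℚ K
  rw [eq_span_zeta_sub_one_of_natCast_mem hζ hP, eq_span_zeta_sub_one_of_natCast_mem hζ hQ]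

theorem span_natCast_eq_pow {P : Ideal (𝓞 K)} [P.IsPrime] (hP : (p : 𝓞 K) ∈ P) :
    Ideal.span {(p : 𝓞 K)} = P ^ (p - 1) := by
  have hζ := IsCyclotomicExtension.zeta_spec p ℚ K
  rw [eq_span_zeta_sub_one_of_natCast_mem hζ hP, Ideal.span_singleton_pow,
    Ideal.span_singleton_eq_span_singleton]
  exact (IsCyclotomicExtension.Rat.associated_zeta_sub_one_pow_prime p hζ).symm

theorem pow_add_sub_one_eq_span_natCast_mul {P : Ideal (𝓞 K)} [P.IsPrime] (hP : (p : 𝓞 K) ∈ P)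
    (m : ℕ) : P ^ (m + p - 1) = Ideal.span {(p : 𝓞 K)} * P ^ m := by
  have hp : p.Prime := Fact.out
  rw [span_natCast_eq_pow hP, ← pow_add, Nat.add_sub_assoc hp.one_le, add_comm]

variable (hv : (p : 𝓞 K) ∈ v.asIdeal)

include hv

theorem valuation_zeta_sub_one {ζ : K} (hζ : IsPrimitiveRoot ζ p) :
    v.valuation K (ζ - 1) = exp (-1) := by
  rw [← v.intValuation_singleton hζ.zeta_sub_one_prime'.ne_zero
    (eq_span_zeta_sub_one_of_natCast_mem hζ hv), ← v.valuation_of_algebraMap (K := K)]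
  congr 1

theorem valuation_natCast_prime_le : v.valuation K p ≤ exp (-((p - 1 : ℕ) : ℤ)) := by
  rw [← map_natCast (algebraMap (𝓞 K) K), v.valuation_of_algebraMap,
    v.intValuation_le_pow_iff_mem, ← span_natCast_eq_pow hv]
  exact Ideal.mem_span_singleton_self _

theorem valuation_intCast_lt_one_iff (n : ℤ) : v.valuation K n < 1 ↔ (p : ℤ) ∣ n := by
  have hζ := IsCyclotomicExtension.zeta_spec p ℚ K
  rw [← map_intCast (algebraMap (𝓞 K) K), v.valuation_lt_one_iff_mem,
    eq_span_zeta_sub_one_of_natCast_mem hζ hv, Ideal.mem_span_singleton,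
    IsCyclotomicExtension.Rat.zeta_sub_one_dvd_intCast_iff' p hζ]

theorem hasPrimeResidueField_of_natCast_mem : HasPrimeResidueField (v.valuation K) := by
  have := liesOver_span_natCast hv
  refine hasPrimeResidueField_valuation (?_ : (Ideal.absNorm v.asIdeal).Prime)
  rw [← Ideal.pow_inertiaDeg (p := p), IsCyclotomicExtension.Rat.inertiaDeg_eq_of_prime p K,
    pow_one]
  exact Fact.out

theorem valuation_galois (σ : K ≃ₐ[ℚ] K) (y : K) : v.valuation K (σ y) = v.valuation K y := by
  let τ := RingOfIntegers.mapRingEquiv (σ : K ≃+* K)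
  have : (v.asIdeal.map τ).IsPrime := Ideal.map_isPrime_of_equiv τ
  have hτ : v.asIdeal.map τ = v.asIdeal :=
    eq_of_natCast_mem (map_natCast τ p ▸ Ideal.mem_map_of_mem τ hv) hv
  exact valuation_map_eq (σ := (σ : K →+* K)) (fun _ => rfl) hτ y

theorem smul_mem_higherUnits (hx : x ∈ higherUnits (v.valuation K) k) (σ : K ≃ₐ[ℚ] K) :
    σ • x ∈ higherUnits (v.valuation K) k := by
  refine ⟨(valuation_galois hv σ x).trans hx.1, ?_⟩
  have h : ((σ • x : Kˣ) : K) - 1 = σ (x - 1) := by rw [map_sub, map_one]; rfl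
  rw [h, valuation_galois hv]
  exact hx.2

theorem pow_prime_mem_higherUnits_succ (hx : x ∈ higherUnits (v.valuation K) 1) :
    x ^ p ∈ higherUnits (v.valuation K) (p + 1) := by
  have hζ := IsCyclotomicExtension.zeta_spec p ℚ K
  exact (hasPrimeResidueField_of_natCast_mem hv).pow_prime_mem_higherUnits_succ Fact.out
    (valuation_natCast_prime_le hv) (ζ := Units.mk0 _ (hζ.ne_zero (NeZero.ne p)))
    (Units.ext hζ.pow_eq_one) (valuation_zeta_sub_one hv hζ) hx

theorem pow_prime_pow_mem_higherUnits_succ {N : ℕ} (hN : 1 ≤ N)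
    (hx : x ∈ higherUnits (v.valuation K) 1) :
    x ^ p ^ N ∈ higherUnits (v.valuation K) (p + 1) := by
  obtain ⟨n, rfl⟩ := Nat.exists_eq_add_of_le hN
  rw [pow_add, pow_one, pow_mul]
  exact pow_mem (pow_prime_mem_higherUnits_succ hv hx) _

theorem pow_prime_pow_mem_higherUnits_two_mul {N : ℕ} (hN : 2 ≤ N)
    (hx : x ∈ higherUnits (v.valuation K) 1) :
    x ^ p ^ N ∈ higherUnits (v.valuation K) (2 * p) := by
  have hp : p.Prime := Fact.out
  have hp2 := hp.two_le
  obtain ⟨n, rfl⟩ := Nat.exists_eq_add_of_le hN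
  rw [pow_add, pow_mul, pow_two, pow_mul]
  exact pow_mem (pow_prime_mem_higherUnits hp (valuation_natCast_prime_le hv)
    (pow_prime_mem_higherUnits_succ hv hx) (by nlinarith) (by omega)) _

end Cyclotomic

section Kummer

open WithZero IsDedekindDomain

theorem leadingCoeff_linear_pow_sub_C {A : Type*} [CommRing A] [IsDomain A] {n : ℕ} (hn : 0 < n)
    {c : A} (hc : c ≠ 0) (d e : A) :
    ((C c * X + C d) ^ n - C e).leadingCoeff = c ^ n := by
  rw [leadingCoeff_sub_of_degree_lt, leadingCoeff_pow, leadingCoeff_linear hc]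
  refine degree_C_le.trans_lt ?_
  rw [degree_pow, degree_linear hc]
  simpa using hn

theorem exists_monic_C_mul_eq_linear_pow_sub_C {A : Type*} [CommRing A] [IsDomain A] {p : ℕ}
    (hp : p.Prime) {π u : A} (hπ : π ≠ 0) (hu : (p : A) = u * π ^ (p - 1)) (d a : A) :
    ∃ g : A[X], g.Monic ∧
      C (π ^ p) * g = (C π * X + C d) ^ p - C (d ^ p + π ^ p * a) ∧
      derivative g = C u * (C π * X + C d) ^ (p - 1) := by
  obtain ⟨r, hr⟩ := exists_add_pow_prime_eq hp (C π * X) (C d)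
  have hπp : (C (π ^ p) : A[X]) ≠ 0 := C_ne_zero.2 (pow_ne_zero p hπ)
  have hpπ : (p : A[X]) * C π = C u * C (π ^ p) := by
    rw [← map_natCast C, hu, ← C_mul, mul_assoc, ← pow_succ, Nat.sub_add_cancel hp.one_le, C_mul]
  have hg : C (π ^ p) * (X ^ p + C u * C d * X * r - C a) =
      (C π * X + C d) ^ p - C (d ^ p + π ^ p * a) := by
    rw [hr]
    simp only [C_pow, C_mul, C_add, mul_pow] at hpπ ⊢
    linear_combination (-(C d * X * r)) * hpπ
  refine ⟨_, mul_left_cancel₀ (pow_ne_zero p hπ) ?_, hg, mul_left_cancel₀ hπp ?_⟩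
  · have hlead := leadingCoeff_linear_pow_sub_C hp.pos hπ d (d ^ p + π ^ p * a)
    rw [← hg, leadingCoeff_mul, leadingCoeff_C] at hlead
    exact hlead.trans (mul_one _).symm
  · rw [← derivative_C_mul, hg]
    simp only [derivative_sub, derivative_C, derivative_pow, derivative_add, derivative_C_mul,
      derivative_X, mul_one, add_zero, sub_zero, map_natCast]
    linear_combination (C π * X + C d) ^ (p - 1) * hpπ

theorem adjoin_singleton_eq_top_of_pow_eq {K L : Type*} [Field K] [Field L] [Algebra K L] {n : ℕ}
    (hn : 0 < n) {ζ : K} (hζ : IsPrimitiveRoot ζ n) {a : K} [IsSplittingField K L (X ^ n - C a)]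
    {b : L} (hb : b ^ n = algebraMap K L a) : Algebra.adjoin K {b} = ⊤ := by
  rw [eq_top_iff, ← IsSplittingField.adjoin_rootSet L (X ^ n - C a), Algebra.adjoin_le_iff]
  intro z hz
  have hz' : z ∈ nthRoots n (algebraMap K L a) := by
    rw [mem_nthRoots hn]
    simpa [sub_eq_zero] using (mem_rootSet.1 hz).2
  rw [(hζ.map_of_injective (algebraMap K L).injective).nthRoots_eq hb, Multiset.mem_map] at hz'
  obtain ⟨i, -, rfl⟩ := hz'
  rw [← map_pow]
  exact mul_mem (Subalgebra.algebraMap_mem _ _) (Algebra.self_mem_adjoin_singleton K b)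

theorem adjoin_singleton_algebraMap_mul_eq_top {K L : Type*} [Field K] [Field L] [Algebra K L]
    {b : L} (hb : Algebra.adjoin K {b} = ⊤) {c : K} (hc : c ≠ 0) :
    Algebra.adjoin K {algebraMap K L c * b} = ⊤ := by
  rw [eq_top_iff, ← hb, Algebra.adjoin_le_iff, Set.singleton_subset_iff]
  have h : b = algebraMap K L c⁻¹ * (algebraMap K L c * b) := by
    rw [← mul_assoc, ← map_mul, inv_mul_cancel₀ hc, map_one, one_mul]
  rw [h]
  exact mul_mem (Subalgebra.algebraMap_mem _ _) (h ▸ Algebra.self_mem_adjoin_singleton K _)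

theorem exists_mul_add_eq_of_comp_eq {A B L : Type*} [CommRing A] [CommRing B] [Field L]
    [Algebra A B] [Algebra A L] [Algebra B L] [IsScalarTower A B L] [IsIntegralClosure B A L]
    [FaithfulSMul A L] {π d : A} (hπ : π ≠ 0) {g f : A[X]} (hg : g.Monic) {n : ℕ}
    (h : C (π ^ n) * g = f.comp (C π * X + C d)) {c : L} (hc : aeval c f = 0) :
    ∃ x : B, algebraMap A L π * algebraMap B L x + algebraMap A L d = c ∧ aeval x g = 0 := by
  have hπL : algebraMap A L π ≠ 0 := by
    rwa [Ne, FaithfulSMul.algebraMap_eq_zero_iff]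
  set y : L := (c - algebraMap A L d) / algebraMap A L π
  have hyc : algebraMap A L π * y + algebraMap A L d = c := by
    simp only [y]; field_simp; ring
  have hgy : aeval y g = 0 := by
    have h' := congrArg (aeval y) h
    rw [map_mul, aeval_comp, map_add, map_mul, aeval_C, aeval_C, aeval_C, aeval_X, hyc, hc,
      map_pow] at h'
    exact (mul_eq_zero.1 h').resolve_left (pow_ne_zero n hπL)
  obtain ⟨x, hx⟩ := (IsIntegralClosure.isIntegral_iff (A := B)).1 (⟨g, hg, hgy⟩ : IsIntegral _ y)
  refine ⟨x, by rw [← hyc, ← hx], IsIntegralClosure.algebraMap_injective B A L ?_⟩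
  rw [← aeval_algebraMap_apply, hx, hgy, map_zero]

variable {K : Type*} [Field K] [NumberField K] {L : Type*} [Field L] [NumberField L] [Algebra K L]

theorem isUnramifiedIn_of_aeval_derivative_notMem {𝔭 : Ideal (𝓞 K)} {x : 𝓞 L}
    (hx : Algebra.adjoin K {algebraMap (𝓞 L) L x} = ⊤) {g : (𝓞 K)[X]} (hg : aeval x g = 0)
    (h : ∀ 𝔓 : Ideal (𝓞 L), 𝔓.IsPrime → 𝔓.LiesOver 𝔭 → aeval x (derivative g) ∉ 𝔓) :
    Algebra.IsUnramifiedIn (𝓞 L) 𝔭 := by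
  intro 𝔓 h𝔓 h𝔓'
  rw [← not_dvd_differentIdeal_iff, Ideal.dvd_iff_le]
  intro hle
  have hmem := hle (aeval_derivative_mem_differentIdeal (𝓞 K) K L x hx)
  obtain ⟨q, hq⟩ := minpoly.isIntegrallyClosed_dvd (Algebra.IsIntegral.isIntegral (R := 𝓞 K) x) hg
  refine h 𝔓 h𝔓 h𝔓' ?_
  rw [hq, derivative_mul, map_add, map_mul, map_mul, minpoly.aeval, zero_mul, add_zero]
  exact Ideal.mul_mem_right _ _ hmem

/-- The generator `(c - d) / π` of `L` is integral, and modulo every prime above `𝔭` it is a simple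
root of an Artin–Schreier polynomial. -/
theorem isUnramifiedIn_of_pow_prime_eq {p : ℕ} (hp : p.Prime) {𝔭 : Ideal (𝓞 K)}
    {π u d a : 𝓞 K} (hπ0 : π ≠ 0) (hπ : π ∈ 𝔭) (hpu : (p : 𝓞 K) = u * π ^ (p - 1)) (hu : u ∉ 𝔭)
    (hd : d ∉ 𝔭) {c : L} (hc : c ^ p = algebraMap (𝓞 K) L (d ^ p + π ^ p * a))
    (hgen : Algebra.adjoin K {c} = ⊤) : Algebra.IsUnramifiedIn (𝓞 L) 𝔭 := by
  obtain ⟨g, hgm, hg, hg'⟩ := exists_monic_C_mul_eq_linear_pow_sub_C hp hπ0 hpu d a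
  obtain ⟨x, hxc, hgx⟩ := exists_mul_add_eq_of_comp_eq (B := 𝓞 L) (c := c) hπ0 hgm
    (f := X ^ p - C (d ^ p + π ^ p * a)) (by simpa using hg) (by simp [hc])
  refine isUnramifiedIn_of_aeval_derivative_notMem (x := x) ?_ hgx fun 𝔓 h𝔓 h𝔓' hmem => ?_
  · rw [eq_top_iff, ← hgen, Algebra.adjoin_le_iff, Set.singleton_subset_iff, ← hxc]
    have hK (z : 𝓞 K) : algebraMap (𝓞 K) L z ∈ Algebra.adjoin K {algebraMap (𝓞 L) L x} :=
      Subalgebra.algebraMap_mem _ (z : K)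
    exact add_mem (mul_mem (hK π) (Algebra.self_mem_adjoin_singleton K _)) (hK d)
  · simp only [hg', map_mul, map_pow, map_add, aeval_C, aeval_X] at hmem
    rcases h𝔓.mem_or_mem hmem with h | h
    · exact hu ((Ideal.mem_of_liesOver 𝔓 𝔭 u).2 h)
    · have hπ𝔓 := Ideal.mul_mem_right x 𝔓 ((Ideal.mem_of_liesOver 𝔓 𝔭 π).1 hπ)
      have hd𝔓 := (Ideal.add_mem_iff_right 𝔓 hπ𝔓).1 (h𝔓.mem_of_pow_mem _ h)
      exact hd ((Ideal.mem_of_liesOver 𝔓 𝔭 d).2 hd𝔓)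

theorem exists_valuation_algebraMap_eq_of_isUnramifiedIn {v : HeightOneSpectrum (𝓞 K)}
    (h : Algebra.IsUnramifiedIn (𝓞 L) v.asIdeal) :
    ∃ w : HeightOneSpectrum (𝓞 L), ∀ y : K, w.valuation L (algebraMap K L y) = v.valuation K y := by
  obtain ⟨⟨P, hP, hPv⟩⟩ := v.asIdeal.nonempty_primesOver (S := 𝓞 L)
  let w : HeightOneSpectrum (𝓞 L) := ⟨P, hP, Ideal.ne_bot_of_liesOver_of_ne_bot v.ne_bot P⟩
  have : w.asIdeal.LiesOver v.asIdeal := hPv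
  have he : v.asIdeal.ramificationIdx' w.asIdeal = 1 := by
    rw [Ideal.ramificationIdx'_eq_ramificationIdx _ _ v.ne_bot]
    exact h.ramificationIdx_eq_one hPv
  exact ⟨w, fun y => by rw [← HeightOneSpectrum.valuation_liesOver L v w y, he, pow_one]⟩

variable {p : ℕ} [Fact p.Prime] [IsCyclotomicExtension {p} ℚ K] {v : HeightOneSpectrum (𝓞 K)}
  (hv : (p : 𝓞 K) ∈ v.asIdeal) {β : Kˣ}

include hv

theorem mem_higherUnits_of_isUnramifiedIn {b : L} (hb : b ^ p = algebraMap K L β)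
    (hβ : β ∈ higherUnits (v.valuation K) 1) (h : Algebra.IsUnramifiedIn (𝓞 L) v.asIdeal) :
    β ∈ higherUnits (v.valuation K) p := by
  have hp : p.Prime := Fact.out
  obtain ⟨w, hw⟩ := exists_valuation_algebraMap_eq_of_isUnramifiedIn h
  have hb0 : b ≠ 0 := by
    rintro rfl
    rw [zero_pow hp.ne_zero, eq_comm, map_eq_zero] at hb
    exact β.ne_zero hb
  have hmem {k : ℕ} (hk : 1 ≤ k) : Units.mk0 b hb0 ^ p ∈ higherUnits (w.valuation L) k ↔
      β ∈ higherUnits (v.valuation K) k := by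
    rw [mem_higherUnits_iff hk, mem_higherUnits_iff hk, Units.val_pow_eq_pow_val, Units.val_mk0,
      hb, ← map_one (algebraMap K L), ← map_sub, hw]
  have hwp : w.valuation L p ≤ exp (-((p - 1 : ℕ) : ℤ)) := by
    rw [← map_natCast (algebraMap K L), hw]
    exact valuation_natCast_prime_le hv
  exact (hmem hp.one_le).1 (pow_prime_mem_higherUnits_of_mem_one hp hwp ((hmem le_rfl).2 hβ))

theorem isUnramifiedIn_of_mem_higherUnits [IsSplittingField K L (X ^ p - C (β : K))] {b : L}
    (hb : b ^ p = algebraMap K L β) (hβ : β ∈ higherUnits (v.valuation K) p) :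
    Algebra.IsUnramifiedIn (𝓞 L) v.asIdeal := by
  have hp : p.Prime := Fact.out
  have hζ := IsCyclotomicExtension.zeta_spec p ℚ K
  have hvπ := eq_span_zeta_sub_one_of_natCast_mem hζ hv
  obtain ⟨u, hu⟩ := IsCyclotomicExtension.Rat.associated_zeta_sub_one_pow_prime p hζ
  obtain ⟨c, hc, d, hd, hdc⟩ := (congrOne_pow_iff_mem_higherUnits hp.one_le).2 hβ
  rw [hvπ, Ideal.span_singleton_pow, Ideal.mem_span_singleton] at hc
  obtain ⟨a, rfl⟩ := hc
  set π := hζ.toInteger - 1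
  have hd0 : (d : K) ≠ 0 := RingOfIntegers.coe_ne_zero_iff.2 fun h => hd (h ▸ zero_mem _)
  refine isUnramifiedIn_of_pow_prime_eq hp (π := π) (u := u) (d := d) (a := d ^ (p - 1) * a)
    (c := algebraMap K L d * b) hζ.zeta_sub_one_prime'.ne_zero
    (hvπ ▸ Ideal.mem_span_singleton_self π) (by rw [← hu, mul_comm])
    (fun h => v.isPrime.ne_top (Ideal.eq_top_of_isUnit_mem _ h u.isUnit)) hd ?_
    (adjoin_singleton_algebraMap_mul_eq_top (adjoin_singleton_eq_top_of_pow_eq hp.pos hζ hb) hd0)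
  have hdβ : (d : K) ^ p * β = ((d ^ p + π ^ p * (d ^ (p - 1) * a) : 𝓞 K) : K) := by
    have hdp : (d : K) ^ p = d ^ (p - 1) * d := by
      rw [← pow_succ, Nat.sub_add_cancel hp.one_le]
    push_cast at hdc ⊢
    rw [hdp]
    linear_combination (d : K) ^ (p - 1) * hdc
  rw [mul_pow, hb, ← map_pow, ← map_mul, hdβ]
  rfl

theorem isPPrimary_iff_mem_higherUnits (hβ : β ∈ higherUnits (v.valuation K) 1) :
    IsPPrimary p v.asIdeal β ↔ β ∈ higherUnits (v.valuation K) p := by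
  have hp : p.Prime := Fact.out
  let F := (X ^ p - C (β : K) : K[X]).SplittingField
  have : NumberField F := NumberField.of_module_finite K F
  obtain ⟨b, hb⟩ := (SplittingField.splits (X ^ p - C (β : K))).exists_eval_eq_zero <| by
    rw [degree_map, degree_X_pow_sub_C hp.pos]
    exact_mod_cast hp.ne_zero
  replace hb : b ^ p = algebraMap K F β := by simpa [sub_eq_zero] using hb
  exact ⟨mem_higherUnits_of_isUnramifiedIn (L := F) hv hb hβ,
    isUnramifiedIn_of_mem_higherUnits (L := F) hv hb⟩

end Kummer

section GroupRing

variable {p : ℕ} [Fact p.Prime] {K : Type*} [Field K] [NumberField K]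
  {θ : (K ≃ₐ[ℚ] K) →* ℤ_[p]} {N : ℕ} {e : MonoidAlgebra ℤ (K ≃ₐ[ℚ] K)}

theorem ApproximatesIdempotent.coeff_eq (he : ApproximatesIdempotent p K θ N e) :
    ∃ f : (K ≃ₐ[ℚ] K) → ℤ_[p], ∀ s,
      (e.coeff s : ℤ_[p]) = Ring.inverse ((p : ℤ_[p]) - 1) * θ s⁻¹ + (p : ℤ_[p]) ^ N * f s := by
  classical
  obtain ⟨f, hf⟩ := he
  refine ⟨f.coeff, fun s => ?_⟩
  have h := congrArg (fun x => x.coeff s) hf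
  simpa [idempotentOf, MonoidAlgebra.coeff_sum, Finsupp.single_apply] using h

theorem ApproximatesIdempotent.exists_coeff_inv_mul_eq (he : ApproximatesIdempotent p K θ N e)
    (σ : K ≃ₐ[ℚ] K) {a : ℕ} (ha : (p : ℤ_[p]) ^ N ∣ θ σ - a) :
    ∃ g : (K ≃ₐ[ℚ] K) → ℤ, ∀ s, e.coeff (σ⁻¹ * s) = a * e.coeff s + (p : ℤ) ^ N * g s := by
  obtain ⟨f, hf⟩ := he.coeff_eq
  obtain ⟨c, hc⟩ := ha
  have h (s : K ≃ₐ[ℚ] K) : (p : ℤ) ^ N ∣ e.coeff (σ⁻¹ * s) - a * e.coeff s := by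
    rw [← PadicInt.pow_p_dvd_int_iff]
    push_cast
    rw [hf, hf, mul_inv_rev, inv_inv, map_mul]
    refine ⟨Ring.inverse ((p : ℤ_[p]) - 1) * θ s⁻¹ * c + f (σ⁻¹ * s) - a * f s, ?_⟩
    linear_combination (Ring.inverse ((p : ℤ_[p]) - 1) * θ s⁻¹) * hc
  choose g hg using h
  exact ⟨g, fun s => by linear_combination hg s⟩

theorem smul_galoisPow (α : Kˣ) (e : MonoidAlgebra ℤ (K ≃ₐ[ℚ] K)) (σ : K ≃ₐ[ℚ] K) :
    σ • galoisPow α e = ∏ s : K ≃ₐ[ℚ] K, (s • α) ^ e.coeff (σ⁻¹ * s) := by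
  rw [galoisPow, Finset.smul_prod',
    ← Equiv.prod_comp (Equiv.mulLeft σ) fun s => (s • α) ^ e.coeff (σ⁻¹ * s)]
  refine Finset.prod_congr rfl fun s _ => ?_
  rw [smul_zpow', Equiv.coe_mulLeft, inv_mul_cancel_left, mul_smul]

theorem ApproximatesIdempotent.exists_smul_galoisPow_eq (he : ApproximatesIdempotent p K θ N e)
    (σ : K ≃ₐ[ℚ] K) {a : ℕ} (ha : (p : ℤ_[p]) ^ N ∣ θ σ - a) (α : Kˣ) :
    ∃ z : Kˣ, σ • galoisPow α e = galoisPow α e ^ a * z ^ p ^ N := by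
  obtain ⟨g, hg⟩ := he.exists_coeff_inv_mul_eq σ ha
  refine ⟨∏ s : K ≃ₐ[ℚ] K, (s • α) ^ g s, ?_⟩
  rw [smul_galoisPow, galoisPow, ← Finset.prod_pow, ← Finset.prod_pow, ← Finset.prod_mul_distrib]
  refine Finset.prod_congr rfl fun s _ => ?_
  rw [hg, zpow_add, mul_comm (a : ℤ), mul_comm ((p : ℤ) ^ N), zpow_mul, zpow_mul, zpow_natCast,
    ← Nat.cast_pow, zpow_natCast]

theorem IsThetaComponent.exists_smul_eq {α β : Kˣ} (h : IsThetaComponent p θ N α β)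
    (σ : K ≃ₐ[ℚ] K) {a : ℕ} (ha : (p : ℤ_[p]) ^ N ∣ θ σ - a) :
    ∃ z : Kˣ, σ • β = β ^ a * z ^ p ^ N := by
  obtain ⟨e, he, x, rfl⟩ := h
  obtain ⟨z, hz⟩ := he.exists_smul_galoisPow_eq σ ha α
  refine ⟨z * σ • x / x ^ a, ?_⟩
  have hx : (x ^ p ^ N) ^ a = (x ^ a) ^ p ^ N := by rw [← pow_mul, ← pow_mul, mul_comm]
  rw [smul_mul', hz, smul_pow', mul_pow, hx, div_pow, mul_pow, mul_assoc, mul_assoc,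
    mul_div_cancel]

end GroupRing

theorem exists_natCast_pow_dvd_sub {p : ℕ} [Fact p.Prime] {N : ℕ} (hN : 1 ≤ N) (x : ℤ_[p]) :
    ∃ a : ℕ, (p : ℤ_[p]) ^ N ∣ x - a ∧ PadicInt.toZMod x = a := by
  have ha : (p : ℤ_[p]) ^ N ∣ x - x.appr N := Ideal.mem_span_singleton.1 (PadicInt.appr_spec N x)
  refine ⟨x.appr N, ha, ?_⟩
  have h := map_dvd PadicInt.toZMod ((dvd_pow_self (p : ℤ_[p]) (by omega)).trans ha)
  rwa [map_natCast, ZMod.natCast_self, zero_dvd_iff, map_sub, map_natCast, sub_eq_zero] at h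

section TeichmullerChar

variable {p : ℕ} [Fact p.Prime] {K : Type*} [Field K] [NumberField K]
  [IsCyclotomicExtension {p} ℚ K]

variable (p) in
theorem toZMod_teichmullerChar (σ : K ≃ₐ[ℚ] K) : PadicInt.toZMod (teichmullerChar p K σ) =
    IsCyclotomicExtension.Rat.galEquivZMod p K σ := by
  have hζ := IsCyclotomicExtension.zeta_spec p ℚ K
  refine ZMod.val_injective p (hζ.pow_inj (ZMod.val_lt _) (ZMod.val_lt _) ?_)
  rw [← teichmullerChar_spec p K σ _ hζ.pow_eq_one,
    ← IsCyclotomicExtension.Rat.galEquivZMod_apply_of_pow_eq p K σ hζ.pow_eq_one]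

variable (p K) in
theorem exists_toZMod_teichmullerChar_pow_eq_pow_iff : ∃ σ : K ≃ₐ[ℚ] K, ∀ k m : ℕ,
    PadicInt.toZMod (teichmullerChar p K σ) ^ k = PadicInt.toZMod (teichmullerChar p K σ) ^ m ↔
      k ≡ m [MOD p - 1] := by
  obtain ⟨u, hu⟩ := IsCyclic.exists_ofOrder_eq_natCard (α := (ZMod p)ˣ)
  rw [Nat.card_eq_fintype_card, ZMod.card_units_eq_totient, Nat.totient_prime Fact.out] at hu
  obtain ⟨σ, rfl⟩ := (IsCyclotomicExtension.Rat.galEquivZMod p K).surjective u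
  refine ⟨σ, fun k m => ?_⟩
  rw [toZMod_teichmullerChar, ← Units.val_pow_eq_pow_val, ← Units.val_pow_eq_pow_val,
    Units.val_inj, pow_eq_pow_iff_modEq, hu]

end TeichmullerChar

section Filtration

open WithZero IsDedekindDomain

variable {p : ℕ} [Fact p.Prime] {K : Type*} [Field K] [NumberField K]
  [IsCyclotomicExtension {p} ℚ K] {v : HeightOneSpectrum (𝓞 K)} (hv : (p : 𝓞 K) ∈ v.asIdeal)

include hv

theorem valuation_natCast_sub_natCast_eq_one {m n : ℕ} (h : (m : ZMod p) ≠ n) :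
    v.valuation K ((m : K) - n) = 1 := by
  have hle : v.valuation K ((m : K) - n) ≤ 1 :=
    (v.valuation K).map_sub_le (valuation_natCast_le_one _ m) (valuation_natCast_le_one _ n)
  refine le_antisymm hle (le_of_not_gt fun hlt => h ?_)
  have hdvd : (p : ℤ) ∣ m - n := (valuation_intCast_lt_one_iff hv _).1 (by simpa using hlt)
  rw [← ZMod.intCast_zmod_eq_zero_iff_dvd] at hdvd
  simpa [sub_eq_zero] using hdvd

theorem valuation_galois_sub_pow_mul_le (σ : K ≃ₐ[ℚ] K) {k : ℕ} {t : K}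
    (ht : v.valuation K t ≤ exp (-(k : ℤ))) :
    v.valuation K (σ t - ((PadicInt.toZMod (teichmullerChar p K σ)).val : K) ^ k * t) ≤
      exp (-((k + 1 : ℕ) : ℤ)) := by
  have hζ := IsCyclotomicExtension.zeta_spec p ℚ K
  have hπ := valuation_zeta_sub_one hv hζ
  refine valuation_map_sub_pow_mul_le (σ := (σ : K →+* K)) (fun c hc =>
    (hasPrimeResidueField_of_natCast_mem hv).valuation_map_sub_lt_one (valuation_galois hv σ) hc)
    hπ (valuation_natCast_le_one _ _) ?_ ht
  have h := valuation_one_add_pow_sub_le _ (lt_one_iff_le_exp_neg_one.2 hπ.le).le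
    (PadicInt.toZMod (teichmullerChar p K σ)).val
  rw [add_sub_cancel, ← teichmullerChar_spec p K σ _ hζ.pow_eq_one] at h
  simpa using h.trans (pow_le_exp_neg (a := 1) (c := 2) hπ.le le_rfl)

theorem mem_higherUnits_one_of_smul_eq {σ : K ≃ₐ[ℚ] K} {x z : Kˣ} {a N : ℕ}
    (hx : x ∈ higherUnits (v.valuation K) 1) (h : σ • x = x ^ a * z ^ p ^ N) :
    z ∈ higherUnits (v.valuation K) 1 :=
  mem_higherUnits_one_of_pow_prime_pow Fact.out (valuation_natCast_lt_one hv) <|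
    (Subgroup.mul_mem_cancel_left _ (pow_mem hx a)).1 (h ▸ smul_mem_higherUnits hv hx σ)

variable {m N : ℕ} (hN : 1 ≤ N) {α β : Kˣ}
  (hβθ : IsThetaComponent p (teichmullerChar p K ^ m) N α β)

include hN hβθ

theorem IsThetaComponent.mem_higherUnits_succ {k : ℕ} (hk : 1 ≤ k)
    (hU : ∀ x ∈ higherUnits (v.valuation K) 1, x ^ p ^ N ∈ higherUnits (v.valuation K) (k + 1))
    (hkm : ¬ k ≡ m [MOD p - 1]) (hβ : β ∈ higherUnits (v.valuation K) k) :
    β ∈ higherUnits (v.valuation K) (k + 1) := by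
  obtain ⟨σ, hσ⟩ := exists_toZMod_teichmullerChar_pow_eq_pow_iff p K
  obtain ⟨a, ha, ha'⟩ := exists_natCast_pow_dvd_sub hN ((teichmullerChar p K ^ m) σ)
  obtain ⟨z, hz⟩ := hβθ.exists_smul_eq σ ha
  have hzU := hU z (mem_higherUnits_one_of_smul_eq hv (higherUnits_anti hk hβ) hz)
  refine mem_higherUnits_succ_of_map_eq hk (σ := (σ : K →+* K)) hβ hzU
    (by simpa using congrArg Units.val hz) (valuation_galois_sub_pow_mul_le hv σ hβ.2) ?_
  rw [← Nat.cast_pow]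
  refine valuation_natCast_sub_natCast_eq_one hv fun h => hkm ((hσ k m).1 ?_)
  rwa [Nat.cast_pow, ZMod.natCast_zmod_val, ← ha', MonoidHom.pow_apply, map_pow] at h

theorem IsThetaComponent.mem_higherUnits_add {k j M : ℕ} (hk : 1 ≤ k) (hkM : k + j ≤ M)
    (hU : ∀ x ∈ higherUnits (v.valuation K) 1, x ^ p ^ N ∈ higherUnits (v.valuation K) M)
    (hkm : ∀ i < j, ¬ k + i ≡ m [MOD p - 1]) (hβ : β ∈ higherUnits (v.valuation K) k) :
    β ∈ higherUnits (v.valuation K) (k + j) := by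
  induction j with
  | zero => exact hβ
  | succ j ih =>
    exact hβθ.mem_higherUnits_succ hv hN (k := k + j) (by omega)
      (fun x hx => higherUnits_anti hkM (hU x hx)) (hkm j (by omega))
      (ih (by omega) fun i hi => hkm i (by omega))

theorem IsThetaComponent.mem_higherUnits_of_mem_one (hm : 1 ≤ m) (hm' : m ≤ p - 2)
    (hβ : β ∈ higherUnits (v.valuation K) 1) : β ∈ higherUnits (v.valuation K) m := by
  have h := hβθ.mem_higherUnits_add hv hN (j := m - 1) le_rfl (by omega)
    (fun x => pow_prime_pow_mem_higherUnits_succ hv hN)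
    (fun i hi h => absurd (Nat.ModEq.eq_of_lt_of_lt h (by omega) (by omega)) (by omega)) hβ
  rwa [Nat.add_sub_cancel' hm] at h

theorem IsThetaComponent.mem_higherUnits_prime (hm : 1 ≤ m) (hm' : m ≤ p - 2)
    (hβ : β ∈ higherUnits (v.valuation K) (p - 1)) : β ∈ higherUnits (v.valuation K) p := by
  have hp : p - 1 + 1 = p := by omega
  have hmod : ¬ p - 1 ≡ m [MOD p - 1] := fun h => by
    have := Nat.ModEq.eq_of_lt_of_lt ((Nat.ModEq.symm (by simp [Nat.ModEq])).trans h)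
      (by omega : 0 < p - 1) (by omega)
    omega
  refine hp ▸ hβθ.mem_higherUnits_succ hv hN (by omega) (fun x hx => ?_) hmod hβ
  exact higherUnits_anti (by omega) (pow_prime_pow_mem_higherUnits_succ hv hN hx)

theorem IsThetaComponent.mem_higherUnits_add_prime_sub_one (hm : 1 ≤ m) (hm' : m ≤ p - 2)
    (hNm : 2 ≤ N ∨ m ≤ 2) (hβ : β ∈ higherUnits (v.valuation K) p) :
    β ∈ higherUnits (v.valuation K) (m + p - 1) := by
  have hU (x : Kˣ) (hx : x ∈ higherUnits (v.valuation K) 1) :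
      x ^ p ^ N ∈ higherUnits (v.valuation K) (m + p - 1) := by
    rcases hNm with hN2 | hm2
    · exact higherUnits_anti (by omega) (pow_prime_pow_mem_higherUnits_two_mul hv hN2 hx)
    · exact higherUnits_anti (by omega) (pow_prime_pow_mem_higherUnits_succ hv hN hx)
  have h := hβθ.mem_higherUnits_add hv hN (j := m - 1) (by omega) (by omega) hU
    (fun i hi h => ?_) hβ
  · rwa [show p + (m - 1) = m + p - 1 by omega] at h
  · have := Nat.le_of_dvd (by omega) ((Nat.modEq_iff_dvd' (by omega)).1 h.symm)
    omega

end Filtration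

theorem CongrOne.galoisPow {p : ℕ} [Fact p.Prime] {K : Type*} [Field K] [NumberField K]
    [IsCyclotomicExtension {p} ℚ K] {𝔭 : Ideal (𝓞 K)} [𝔭.IsPrime] (h𝔭 : (p : 𝓞 K) ∈ 𝔭) {α : Kˣ}
    (hα : CongrOne 𝔭 𝔭 α) (e : MonoidAlgebra ℤ (K ≃ₐ[ℚ] K)) :
    CongrOne 𝔭 𝔭 (galoisPow α e) := by
  obtain ⟨v, rfl⟩ := exists_heightOneSpectrum_asIdeal_eq h𝔭
  rw [congrOne_iff_mem_higherUnits_one] at hα ⊢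
  exact prod_mem fun s _ => zpow_mem (smul_mem_higherUnits h𝔭 hα s) _

theorem proposition2p4_general (p : ℕ) [Fact p.Prime]
    (K : Type*) [Field K] [NumberField K] [IsCyclotomicExtension {p} ℚ K]
    (𝔭 : Ideal (𝓞 K)) [𝔭.IsPrime] (h𝔭 : (p : 𝓞 K) ∈ 𝔭) (m : ℕ) (hm : 1 ≤ m) (hm' : m ≤ p - 2)
    (N : ℕ) (hN : 1 ≤ N) (α β : Kˣ) (hβθ : IsThetaComponent p (teichmullerChar p K ^ m) N α β)
    (hβ : CongrOne 𝔭 𝔭 β) :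
    CongrOne 𝔭 (𝔭 ^ m) β ∧
    (IsPPrimary p 𝔭 β ↔ CongrOne 𝔭 (Ideal.span {(p : 𝓞 K)}) β) ∧
    (2 ≤ N ∨ m ≤ 2 → IsPPrimary p 𝔭 β → CongrOne 𝔭 (𝔭 ^ (m + p - 1)) β) := by
  obtain ⟨v, rfl⟩ := exists_heightOneSpectrum_asIdeal_eq h𝔭
  rw [congrOne_iff_mem_higherUnits_one] at hβ
  rw [isPPrimary_iff_mem_higherUnits h𝔭 hβ, span_natCast_eq_pow h𝔭,
    congrOne_pow_iff_mem_higherUnits hm, congrOne_pow_iff_mem_higherUnits (by omega),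
    congrOne_pow_iff_mem_higherUnits (by omega)]
  exact ⟨hβθ.mem_higherUnits_of_mem_one h𝔭 hN hm hm' hβ,
    ⟨fun h => higherUnits_anti (p.sub_le 1) h, hβθ.mem_higherUnits_prime h𝔭 hN hm hm'⟩,
    hβθ.mem_higherUnits_add_prime_sub_one h𝔭 hN hm hm'⟩

theorem proposition2p4 (p : ℕ) [Fact p.Prime]
    (K : Type*) [Field K] [NumberField K] [IsCyclotomicExtension {p} ℚ K]
    (𝔭 : Ideal (𝓞 K)) [𝔭.IsPrime] (h𝔭 : (p : 𝓞 K) ∈ 𝔭)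
    (α : Kˣ) (hα : CongrOne 𝔭 𝔭 α)
    (m : ℕ) (hm : 2 ≤ m) (hm' : m ≤ p - 2) :
    𝔭 ^ (m + p - 1) = Ideal.span {(p : 𝓞 K)} * 𝔭 ^ m ∧
    ∀ N : ℕ, 1 ≤ N →
      (∀ e : MonoidAlgebra ℤ (K ≃ₐ[ℚ] K),
        ApproximatesIdempotent p K (teichmullerChar p K ^ m) N e →
          CongrOne 𝔭 𝔭 (galoisPow α e)) ∧
      ∀ β : Kˣ, IsThetaComponent p (teichmullerChar p K ^ m) N α β → CongrOne 𝔭 𝔭 β →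
        CongrOne 𝔭 (𝔭 ^ m) β ∧
        (IsPPrimary p 𝔭 β ↔ CongrOne 𝔭 (Ideal.span {(p : 𝓞 K)}) β) ∧
        (2 ≤ N ∨ m = 2 → IsPPrimary p 𝔭 β → CongrOne 𝔭 (𝔭 ^ (m + p - 1)) β) := by
  refine ⟨pow_add_sub_one_eq_span_natCast_mul h𝔭 m,
    fun N hN => ⟨fun e _ => hα.galoisPow h𝔭 e, fun β hβθ hβ => ?_⟩⟩
  exact (proposition2p4_general p K 𝔭 h𝔭 m (by omega) hm' N hN α β hβθ hβ).imp_right <|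
    And.imp_right fun h hNm => h (hNm.imp_right Eq.le)
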